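/- Let $\mathcal X$ be a real inner product space of dimension greater than $1$ (possibly infinite), let $\mathbf B=\{x\in\mathcal X:\|x\|<R\}$ with $R>0$ be an open ball centred at the origin, and let $\mathcal Y$ be a real sequentially complete topological vector space. Let $r,s,t$ be positive integers with $s=t>\frac{1}{\sqrt2}\,r$, and let $f:\mathbf B\setminus\{0\}\to\mathcal Y$ be orthogonally generalized Jensen, that is, $$ r\,f\!\left(\frac{sx+ty}{r}\right)=s\,f(x)+t\,f(y) $$ for all $x,y\in\mathbf B\setminus\{0\}$ with $\langle x,y\rangle=0$ and $\frac{sx+ty}{r}\in\mathbf B\setminus\{0\}$. Then there exist additive mappings $T:\mathcal X\to\mathcal Y$ and $b:[0,\infty)\to\mathcal Y$ such that $$ f(x)=T(x)+b\!\left(\|x\|^2\right)\qquad\text{for all }x\in\mathbf B\setminus\{0\}. $$ -/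

import Mathlib

/-- `f` satisfies the generalized Jensen equation `r f((s x + t y) / r) = s f(x) + t f(y)` for all
orthogonal `x, y` in the domain `D` for which `(s x + t y) / r` lies in `D` as well
(the values of `f` outside `D` play no role). -/
def IsOrthogonallyGeneralizedJensenOn {X Y : Type*} [NormedAddCommGroup X] [InnerProductSpace ℝ X]
    [AddCommGroup Y] [Module ℝ Y] (r s t : ℕ) (D : Set X) (f : X → Y) : Prop :=
  ∀ x ∈ D, ∀ y ∈ D, inner ℝ x y = 0 →
    (r : ℝ)⁻¹ • ((s : ℝ) • x + (t : ℝ) • y) ∈ D →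
      (r : ℝ) • f ((r : ℝ)⁻¹ • ((s : ℝ) • x + (t : ℝ) • y)) = (s : ℝ) • f x + (t : ℝ) • f y

/-- Every Cauchy sequence converges. -/
def IsSequentiallyComplete (Y : Type*) [UniformSpace Y] : Prop :=
  ∀ u : ℕ → Y, CauchySeq u → ∃ a : Y, Filter.Tendsto u Filter.atTop (nhds a)

/-!
Put `l = s / r`, so that `2 l ^ 2 > 1`. If `⟪x, y⟫ = 0` and `‖y‖ ^ 2 = a b ‖x‖ ^ 2`, then
`l (a x + y)` and `l (b x - y)` are orthogonal, so an odd solution restricted to a line satisfies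
`h (l ^ 2 (a + b)) = l ^ 2 (h a + h b)` near `0`. An even solution is radial near `0`, say
`f x = h (‖x‖ ^ 2)`, and `h (l ^ 2 (a + b)) = l (h a + h b)`. In both cases `h a + h b` depends only
on `a + b`, which makes `h` affine; its constant term vanishes because `2 l ^ 2 ≠ 1` and `2 l ≠ 1`.
Since `l` is rational, additivity on lines together with the equation makes an odd solution
additive on orthogonal pairs, hence additive near `0`.

So `f` agrees near `0` with a sum `T + A (‖·‖ ^ 2)` which is itself a solution. Every `z` equals
`l (p + q)` with `p ⟂ q` and `‖p‖ = ‖q‖ = ‖z‖ / (√2 l) < ‖z‖`, so a solution that vanishes near `0`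
vanishes on the whole punctured ball.
-/

open Filter Metric Set
open scoped Topology

section LocalAdditivity

variable {E Y : Type*} [SeminormedAddCommGroup E] [NormedSpace ℝ E] [AddCommGroup Y] {ρ : ℝ}

theorem exists_addMonoidHom_eqOn_ball {g : E → Y}
    (hg : ∀ u ∈ ball 0 ρ, ∀ v ∈ ball 0 ρ, u + v ∈ ball 0 ρ → g (u + v) = g u + g v) :
    ∃ T : E →+ Y, EqOn g T (ball 0 ρ) := by
  rcases le_or_gt ρ 0 with hρ | hρ
  · exact ⟨0, by simp [ball_eq_empty.mpr hρ]⟩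
  have pow_nsmul_apply (n : ℕ) {x : E} (hx : x ∈ ball 0 ρ) :
      2 ^ n • g ((2⁻¹ : ℝ) ^ n • x) = g x := by
    induction n generalizing x with
    | zero => simp
    | succ n ih =>
      have half_add_half : (2⁻¹ : ℝ) • x + (2⁻¹ : ℝ) • x = x := by module
      have half_mem : (2⁻¹ : ℝ) • x ∈ ball 0 ρ := by
        rw [mem_ball_zero_iff, norm_smul] at *
        norm_num
        linarith [norm_nonneg x]
      rw [pow_succ (2⁻¹ : ℝ), mul_smul, pow_succ', mul_smul, ih half_mem, two_nsmul,
        ← hg _ half_mem _ half_mem (by rwa [half_add_half]), half_add_half]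
  have eventually_mem (x : E) : ∀ᶠ n : ℕ in atTop, (2⁻¹ : ℝ) ^ n • x ∈ ball 0 ρ := by
    have h : Tendsto (fun n : ℕ => (2⁻¹ : ℝ) ^ n • x) atTop (𝓝 0) := by
      simpa using (tendsto_pow_atTop_nhds_zero_of_lt_one (by norm_num)
        (by norm_num : (2⁻¹ : ℝ) < 1)).smul_const x
    exact h.eventually_mem (ball_mem_nhds 0 hρ)
  have eventually_const (x : E) : ∃ y, ∀ᶠ n : ℕ in atTop, 2 ^ n • g ((2⁻¹ : ℝ) ^ n • x) = y := by
    obtain ⟨N, hN⟩ := (eventually_mem x).exists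
    refine ⟨2 ^ N • g ((2⁻¹ : ℝ) ^ N • x), eventually_atTop.mpr ⟨N, fun n hn => ?_⟩⟩
    obtain ⟨k, rfl⟩ := Nat.exists_eq_add_of_le hn
    rw [pow_add, mul_smul, pow_add, mul_comm (_ ^ N), mul_smul _ _ x, pow_nsmul_apply k hN]
  choose T hT using eventually_const
  refine ⟨AddMonoidHom.mk' T fun x y => ?_, fun x hx => ?_⟩
  · obtain ⟨n, hx, hy, hxy, hx', hy', hxy'⟩ := ((hT x).and <| (hT y).and <| (hT (x + y)).and <|
      (eventually_mem x).and <| (eventually_mem y).and (eventually_mem (x + y))).exists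
    rw [smul_add] at hxy hxy'
    rw [← hx, ← hy, ← hxy, hg _ hx' _ hy' hxy', smul_add]
  · obtain ⟨n, hn⟩ := (hT x).exists
    exact (pow_nsmul_apply n hx).symm.trans hn

theorem exists_addMonoidHom_add_const_of_jensen_ball {h : E → Y} {x₀ : E}
    (H : ∀ a ∈ ball x₀ ρ, ∀ b ∈ ball x₀ ρ, ∀ c ∈ ball x₀ ρ, ∀ d ∈ ball x₀ ρ,
      a + b = c + d → h a + h b = h c + h d) :
    ∃ (A : E →+ Y) (c : Y), ∀ a ∈ ball x₀ ρ, h a = A a + c := by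
  obtain ⟨A, hA⟩ := exists_addMonoidHom_eqOn_ball (ρ := ρ) (g := fun u => h (x₀ + u) - h x₀) <| by
    intro u hu v hv huv
    have mem_iff (w : E) : x₀ + w ∈ ball x₀ ρ ↔ w ∈ ball 0 ρ := by simp
    have hx₀ : x₀ ∈ ball x₀ ρ := mem_ball_self (pos_of_mem_ball hu)
    have := H _ ((mem_iff _).mpr huv) _ hx₀ _ ((mem_iff _).mpr hu) _ ((mem_iff _).mpr hv) (by abel)
    rw [sub_add_sub_comm, ← this]
    abel
  refine ⟨A, h x₀ - A x₀, fun a ha => ?_⟩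
  have := hA (x := a - x₀) (by simpa [dist_eq_norm] using ha)
  simp only [add_sub_cancel, map_sub] at this
  rw [← sub_add_cancel (h a) (h x₀), this]
  abel

end LocalAdditivity

theorem eq_zero_and_addMonoidHom_eq_zero_of_const {Y : Type*} [AddCommGroup Y] {B : ℝ →+ Y} {c : Y}
    {ε : ℝ} (hε : 0 < ε) (hB : ∀ t, 0 < t → t < ε → B t = c) : c = 0 ∧ B = 0 := by
  have hc : c = 0 := by
    have h := B.map_add (ε / 3) (ε / 3)
    rw [hB _ (by linarith) (by linarith), hB _ (by linarith) (by linarith)] at h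
    simpa using h
  have apply_pos (t : ℝ) (ht : 0 < t) : B t = 0 := by
    obtain ⟨n, hn⟩ := exists_nat_gt (t / ε)
    have hn0 : (0 : ℝ) < n := (by positivity : 0 < t / ε).trans hn
    rw [show t = n • (t / n) by rw [nsmul_eq_mul]; field_simp, map_nsmul,
      hB _ (by positivity) ((div_lt_comm₀ hn0 hε).mpr hn), hc, smul_zero]
  refine ⟨hc, AddMonoidHom.ext fun t => ?_⟩
  rcases lt_trichotomy t 0 with ht | rfl | ht
  · simpa using apply_pos (-t) (neg_pos.mpr ht)
  · exact map_zero B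
  · exact apply_pos t ht

theorem exists_addMonoidHom_of_scaled_jensen {Y : Type*} [AddCommGroup Y] [Module ℝ Y]
    {h : ℝ → Y} {m k ρ : ℝ} (hm : 0 < m) (hk : k ≠ 0) (hk2 : 2 * k ≠ 1) (hρ : 0 < ρ)
    (H : ∀ a b, 0 < a → 0 < b → a + b < ρ → h (m * (a + b)) = k • (h a + h b)) :
    ∃ A : ℝ →+ Y, (∀ a, 0 < a → a < ρ / 2 → h a = A a) ∧ ∀ t, A (m * t) = k • A t := by
  have mem_ball_iff (a : ℝ) : a ∈ ball (ρ / 4) (ρ / 4) ↔ 0 < a ∧ a < ρ / 2 := by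
    rw [Real.ball_eq_Ioo, mem_Ioo]
    ring_nf
  obtain ⟨A, c, hA⟩ := exists_addMonoidHom_add_const_of_jensen_ball (h := h) (x₀ := ρ / 4)
    (ρ := ρ / 4) <| by
      simp only [mem_ball_iff]
      rintro a ⟨ha, ha'⟩ b ⟨hb, hb'⟩ c ⟨hc, hc'⟩ d ⟨hd, hd'⟩ habcd
      refine smul_right_injective Y hk ?_
      simp only [← H a b ha hb (by linarith), ← H c d hc hd (by linarith), habcd]
  simp only [mem_ball_iff] at hA
  let B : ℝ →+ Y := A.comp (AddMonoidHom.mulLeft m) - (DistribSMul.toAddMonoidHom Y k).comp A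
  have B_apply (t : ℝ) : B t = A (m * t) - k • A t := rfl
  obtain ⟨hc, hB⟩ := eq_zero_and_addMonoidHom_eq_zero_of_const (B := B) (c := (2 * k - 1) • c)
    (ε := min (ρ / 2) (ρ / 2 / m)) (by positivity) fun t ht htε => by
      obtain ⟨ht₁, ht₂⟩ := lt_min_iff.mp htε
      rw [lt_div_iff₀' hm] at ht₂
      have key := H (t / 2) (t / 2) (by positivity) (by positivity) (by linarith)
      rw [add_halves, hA (m * t) ⟨by positivity, ht₂⟩, hA (t / 2) ⟨by positivity, by linarith⟩,
        add_add_add_comm, ← map_add, add_halves] at key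
      rw [B_apply]
      linear_combination (norm := module) key
  have hc : c = 0 := (smul_eq_zero.mp hc).resolve_left (sub_ne_zero.mpr hk2)
  refine ⟨A, fun a ha ha' => by rw [hA a ⟨ha, ha'⟩, hc, add_zero], fun t => ?_⟩
  rw [← sub_eq_zero, ← B_apply, hB, AddMonoidHom.zero_apply]

section Orthogonality

variable {X : Type*} [NormedAddCommGroup X] [InnerProductSpace ℝ X]

theorem exists_inner_eq_zero_and_norm_eq (hX : 1 < Module.rank ℝ X) (x : X) {ρ : ℝ} (hρ : 0 ≤ ρ) :
    ∃ y : X, inner ℝ x y = 0 ∧ ‖y‖ = ρ := by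
  have orthogonal_ne_bot : (ℝ ∙ x)ᗮ ≠ ⊥ := by
    rw [ne_eq, Submodule.orthogonal_eq_bot_iff]
    intro span_eq_top
    have rank_le : Module.rank ℝ (ℝ ∙ x) ≤ 1 := by simpa using rank_span_le (R := ℝ) {x}
    rw [span_eq_top, rank_top] at rank_le
    exact rank_le.not_gt hX
  have : Nontrivial (ℝ ∙ x)ᗮ := Submodule.nontrivial_iff_ne_bot.mpr orthogonal_ne_bot
  obtain ⟨y, hy⟩ := exists_norm_eq (ℝ ∙ x)ᗮ hρ
  exact ⟨y, Submodule.mem_orthogonal_singleton_iff_inner_right.mp y.2, hy⟩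

theorem norm_add_sq_of_inner_eq_zero {x y : X} (h : inner ℝ x y = 0) :
    ‖x + y‖ ^ 2 = ‖x‖ ^ 2 + ‖y‖ ^ 2 := by
  simpa only [sq] using norm_add_sq_eq_norm_sq_add_norm_sq_real h

theorem norm_left_le_norm_add_of_inner_eq_zero {x y : X} (h : inner ℝ x y = 0) :
    ‖x‖ ≤ ‖x + y‖ := by
  rw [← sq_le_sq₀ (norm_nonneg _) (norm_nonneg _), norm_add_sq_of_inner_eq_zero h]
  exact le_add_of_nonneg_right (sq_nonneg _)

theorem norm_right_le_norm_add_of_inner_eq_zero {x y : X} (h : inner ℝ x y = 0) :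
    ‖y‖ ≤ ‖x + y‖ := by
  rw [add_comm]
  exact norm_left_le_norm_add_of_inner_eq_zero (inner_eq_zero_symm.mp h)

theorem add_ne_zero_of_inner_eq_zero {x y : X} (h : inner ℝ x y = 0) (hx : x ≠ 0) : x + y ≠ 0 :=
  norm_pos_iff.mp <| (norm_pos_iff.mpr hx).trans_le (norm_left_le_norm_add_of_inner_eq_zero h)

theorem exists_orthogonal_smul_add_smul_sub {l : ℝ} (hl : l ≠ 0) {u v : X} (huv : ‖u‖ = ‖v‖) :
    ∃ p q : X, inner ℝ p q = 0 ∧ l • (p + q) = u ∧ l • (p - q) = v := by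
  refine ⟨(2 * l)⁻¹ • (u + v), (2 * l)⁻¹ • (u - v), ?_, ?_, ?_⟩
  · rw [inner_smul_left, inner_smul_right, (real_inner_add_sub_eq_zero_iff u v).mpr huv, mul_zero,
      mul_zero]
  all_goals match_scalars <;> field_simp <;> norm_num

theorem exists_orthogonal_smul_add_eq (hX : 1 < Module.rank ℝ X) {l : ℝ} (hl : l ≠ 0) (z : X) :
    ∃ p q : X, inner ℝ p q = 0 ∧ l • (p + q) = z ∧ ‖p‖ = ‖q‖ ∧ 2 * l ^ 2 * ‖p‖ ^ 2 = ‖z‖ ^ 2 := by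
  obtain ⟨w, hzw, hw⟩ := exists_inner_eq_zero_and_norm_eq hX z (norm_nonneg z)
  obtain ⟨p, q, hpq, rfl, rfl⟩ := exists_orthogonal_smul_add_smul_sub hl hw.symm
  have norm_eq : ‖p‖ = ‖q‖ := by
    rw [← real_inner_add_sub_eq_zero_iff]
    simpa only [inner_smul_left, inner_smul_right, conj_trivial, mul_eq_zero, hl, false_or]
      using hzw
  refine ⟨p, q, hpq, rfl, norm_eq, ?_⟩
  rw [norm_smul, mul_pow, norm_add_sq_of_inner_eq_zero hpq, ← norm_eq, Real.norm_eq_abs, sq_abs]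
  ring

theorem map_add_of_map_add_orthogonal_of_map_add_line {Y : Type*} [AddSemigroup Y] {g : X → Y}
    {δ : ℝ} (horth : ∀ x y, inner ℝ x y = 0 → ‖x + y‖ < δ → g (x + y) = g x + g y)
    (hline : ∀ (x : X) (a b : ℝ), ‖a • x‖ < δ → ‖b • x‖ < δ → ‖(a + b) • x‖ < δ →
      g ((a + b) • x) = g (a • x) + g (b • x))
    {u v : X} (hu : ‖u‖ < δ) (hv : ‖v‖ < δ) (huv : ‖u + v‖ < δ) : g (u + v) = g u + g v := by
  obtain ⟨y, hy, w, hw, rfl⟩ := (ℝ ∙ u).exists_add_mem_mem_orthogonal v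
  obtain ⟨β, rfl⟩ := Submodule.mem_span_singleton.mp hy
  have inner_smul_w (c : ℝ) : inner ℝ (c • u) w = 0 := by
    rw [inner_smul_left, Submodule.mem_orthogonal_singleton_iff_inner_right.mp hw, mul_zero]
  have add_eq : u + (β • u + w) = (1 + β) • u + w := by module
  rw [add_eq] at huv ⊢
  have hβ := (norm_left_le_norm_add_of_inner_eq_zero (inner_smul_w β)).trans_lt hv
  have h1β := (norm_left_le_norm_add_of_inner_eq_zero (inner_smul_w (1 + β))).trans_lt huv
  rw [horth _ _ (inner_smul_w _) huv, horth _ _ (inner_smul_w _) hv,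
    hline u 1 β (by rwa [one_smul]) hβ h1β, one_smul, add_assoc]

end Orthogonality

/-- The orthogonally Jensen equation with ratio `l = s / r = t / r`, for orthogonal nonzero vectors
of norm less than `R` whose scaled sum has norm less than `R`. -/
def IsOrthJensenBelow {X Y : Type*} [NormedAddCommGroup X] [InnerProductSpace ℝ X]
    [AddCommGroup Y] [Module ℝ Y] (l R : ℝ) (f : X → Y) : Prop :=
  ∀ ⦃x y : X⦄, x ≠ 0 → y ≠ 0 → inner ℝ x y = 0 → ‖x‖ < R → ‖y‖ < R → ‖l • (x + y)‖ < R →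
    f (l • (x + y)) = l • (f x + f y)

namespace IsOrthJensenBelow

variable {X Y : Type*} [NormedAddCommGroup X] [InnerProductSpace ℝ X] [AddCommGroup Y] [Module ℝ Y]
  {l R : ℝ} {f g : X → Y}

theorem add (hf : IsOrthJensenBelow l R f) (hg : IsOrthJensenBelow l R g) :
    IsOrthJensenBelow l R (f + g) := by
  intro x y hx hy hxy hxR hyR hR
  simp only [Pi.add_apply, hf hx hy hxy hxR hyR hR, hg hx hy hxy hxR hyR hR]
  module

theorem const_smul (hf : IsOrthJensenBelow l R f) (c : ℝ) : IsOrthJensenBelow l R (c • f) := by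
  intro x y hx hy hxy hxR hyR hR
  simp only [Pi.smul_apply, hf hx hy hxy hxR hyR hR]
  module

theorem sub (hf : IsOrthJensenBelow l R f) (hg : IsOrthJensenBelow l R g) :
    IsOrthJensenBelow l R (f - g) := by
  simpa [sub_eq_add_neg] using hf.add (hg.const_smul (-1))

theorem comp_neg (hf : IsOrthJensenBelow l R f) : IsOrthJensenBelow l R (fun x => f (-x)) := by
  intro x y hx hy hxy hxR hyR hR
  have := hf (neg_ne_zero.mpr hx) (neg_ne_zero.mpr hy) (by rwa [inner_neg_neg])
    (by rwa [norm_neg]) (by rwa [norm_neg]) (by rwa [← neg_add, smul_neg, norm_neg])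
  rwa [← neg_add, smul_neg] at this

theorem of_addMonoidHom {T : X →+ Y} (hT : ∀ x, T (l • x) = l • T x) :
    IsOrthJensenBelow l R T := by
  intro x y _ _ _ _ _ _
  rw [hT, map_add]

theorem comp_norm_sq {A : ℝ →+ Y} (hA : ∀ t, A (l ^ 2 * t) = l • A t) :
    IsOrthJensenBelow l R fun x : X => A (‖x‖ ^ 2) := by
  intro x y _ _ hxy _ _ _
  simp only [norm_smul, mul_pow, Real.norm_eq_abs, sq_abs]
  rw [hA, norm_add_sq_of_inner_eq_zero hxy, map_add]

theorem apply_smul_add (hl : 0 < l) (hf : IsOrthJensenBelow l R f) {x y : X} (hx : x ≠ 0)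
    (hy : y ≠ 0) (hxy : inner ℝ x y = 0) (hR : (1 + l) * ‖x + y‖ < R) :
    f (l • (x + y)) = l • (f x + f y) := by
  have hlR : 0 ≤ l * ‖x + y‖ := by positivity
  refine hf hx hy hxy ?_ ?_ ?_
  · linarith [norm_left_le_norm_add_of_inner_eq_zero hxy]
  · linarith [norm_right_le_norm_add_of_inner_eq_zero hxy]
  · rw [norm_smul, Real.norm_of_nonneg hl.le]
    linarith [norm_nonneg (x + y)]

theorem eq_zero_of_eventually_eq_zero (hX : 1 < Module.rank ℝ X) (hl : 1 < 2 * l ^ 2)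
    (hf : IsOrthJensenBelow l R f) (h0 : ∀ᶠ x in 𝓝[≠] 0, f x = 0) {x : X} (hx : x ≠ 0)
    (hxR : ‖x‖ < R) : f x = 0 := by
  have hl0 : l ≠ 0 := by
    rintro rfl
    norm_num at hl
  obtain ⟨δ, hδ, hfδ⟩ := nhdsWithin_basis_ball.eventually_iff.mp h0
  have eq_zero_of_norm_sq_lt (n : ℕ) {z : X} (hz : z ≠ 0) (hzR : ‖z‖ < R)
      (hzn : ‖z‖ ^ 2 < (2 * l ^ 2) ^ n * δ ^ 2) : f z = 0 := by
    induction n generalizing z with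
    | zero =>
      rw [pow_zero, one_mul, sq_lt_sq₀ (norm_nonneg z) hδ.le] at hzn
      exact hfδ ⟨mem_ball_zero_iff.mpr hzn, hz⟩
    | succ n ih =>
      obtain ⟨p, q, hpq, rfl, norm_eq, norm_sq⟩ := exists_orthogonal_smul_add_eq hX hl0 z
      have norm_lt : ‖p‖ < ‖l • (p + q)‖ := by
        have hz' := pow_pos (norm_pos_iff.mpr hz) 2
        rw [← sq_lt_sq₀ (norm_nonneg _) (norm_nonneg _)]
        nlinarith
      have norm_sq_lt : ‖p‖ ^ 2 < (2 * l ^ 2) ^ n * δ ^ 2 := by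
        rw [← norm_sq, pow_succ' (2 * l ^ 2), mul_assoc (2 * l ^ 2) (_ ^ n)] at hzn
        exact lt_of_mul_lt_mul_left hzn (by positivity)
      have hp : p ≠ 0 := by
        rintro rfl
        exact hz (by simpa using norm_sq.symm)
      have hq : q ≠ 0 := norm_ne_zero_iff.mp (norm_eq ▸ norm_ne_zero_iff.mpr hp)
      have hpR := norm_lt.trans hzR
      rw [hf hp hq hpq hpR (norm_eq ▸ hpR) hzR, ih hp hpR norm_sq_lt,
        ih hq (norm_eq ▸ hpR) (norm_eq ▸ norm_sq_lt), add_zero, smul_zero]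
  obtain ⟨n, hn⟩ := pow_unbounded_of_one_lt (‖x‖ ^ 2 / δ ^ 2) hl
  exact eq_zero_of_norm_sq_lt n hx hxR ((div_lt_iff₀ (by positivity)).mp hn)

section Even

theorem apply_eq_of_norm_eq_of_even (hl : 0 < l) (hf : IsOrthJensenBelow l R f)
    (heven : f.Even) {u v : X} (huv : ‖u‖ = ‖v‖) (hu : ‖u‖ < R) (hu' : ‖u‖ < l * R) :
    f u = f v := by
  obtain ⟨p, q, hpq, rfl, rfl⟩ := exists_orthogonal_smul_add_smul_sub hl.ne' huv
  rcases eq_or_ne p 0 with rfl | hp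
  · rw [zero_add, zero_sub, smul_neg, heven]
  rcases eq_or_ne q 0 with rfl | hq
  · rw [add_zero, sub_zero]
  have norm_add_lt : ‖p + q‖ < R := by
    rw [norm_smul, Real.norm_of_nonneg hl.le] at hu'
    exact lt_of_mul_lt_mul_left hu' hl.le
  have hpR := (norm_left_le_norm_add_of_inner_eq_zero hpq).trans_lt norm_add_lt
  have hqR := (norm_right_le_norm_add_of_inner_eq_zero hpq).trans_lt norm_add_lt
  rw [sub_eq_add_neg] at huv ⊢
  rw [hf hp hq hpq hpR hqR hu, hf hp (neg_ne_zero.mpr hq) (by rw [inner_neg_right, hpq, neg_zero])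
    hpR (by rwa [norm_neg]) (huv ▸ hu), heven]

theorem exists_radial_profile_of_even (hX : 1 < Module.rank ℝ X) (hl : 0 < l) (hR : 0 < R)
    (hf : IsOrthJensenBelow l R f) (heven : f.Even) :
    ∃ (h : ℝ → Y) (ρ : ℝ), 0 < ρ ∧ (∀ x, ‖x‖ < ρ → f x = h (‖x‖ ^ 2)) ∧
      ∀ a b, 0 < a → 0 < b → a + b < ρ ^ 2 → h (l ^ 2 * (a + b)) = l • (h a + h b) := by
  obtain ⟨e, -, he⟩ := exists_inner_eq_zero_and_norm_eq hX 0 zero_le_one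
  obtain ⟨e', hee', he'⟩ := exists_inner_eq_zero_and_norm_eq hX e zero_le_one
  have norm_sqrt_smul (a : ℝ) {w : X} (hw : ‖w‖ = 1) : ‖√a • w‖ = √a := by
    rw [norm_smul, hw, mul_one, Real.norm_of_nonneg (Real.sqrt_nonneg a)]
  have sqrt_smul_ne_zero {a : ℝ} (ha : 0 < a) {w : X} (hw : ‖w‖ = 1) : √a • w ≠ 0 := by
    rw [← norm_pos_iff, norm_sqrt_smul a hw]
    exact Real.sqrt_pos.mpr ha
  have apply_eq {x : X} (hx : ‖x‖ < R) (hx' : ‖x‖ < l * R) : f x = f (√(‖x‖ ^ 2) • e) :=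
    hf.apply_eq_of_norm_eq_of_even hl heven
      (by rw [norm_sqrt_smul _ he, Real.sqrt_sq (norm_nonneg x)]) hx hx'
  obtain ⟨ρ, hρ, hρR, hρlR⟩ : ∃ ρ > 0, (1 + l) * ρ ≤ R ∧ ρ ≤ l * R :=
    ⟨min (R / (1 + l)) (l * R), by positivity,
      (le_div_iff₀' (by positivity)).mp (min_le_left _ _), min_le_right _ _⟩
  have hlρ : 0 < l * ρ := by positivity
  refine ⟨fun a => f (√a • e), ρ, hρ, fun x hx => apply_eq (by linarith) (by linarith),
    fun a b ha hb hab => ?_⟩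
  have hxy : inner ℝ (√a • e) (√b • e') = 0 := by
    rw [inner_smul_left, inner_smul_right, hee', mul_zero, mul_zero]
  have norm_sq : ‖√a • e + √b • e'‖ ^ 2 = a + b := by
    rw [norm_add_sq_of_inner_eq_zero hxy, norm_sqrt_smul a he, norm_sqrt_smul b he',
      Real.sq_sqrt ha.le, Real.sq_sqrt hb.le]
  have norm_lt : ‖√a • e + √b • e'‖ < ρ := by rwa [← sq_lt_sq₀ (norm_nonneg _) hρ.le, norm_sq]
  have norm_right_lt := (norm_right_le_norm_add_of_inner_eq_zero hxy).trans_lt norm_lt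
  have norm_smul_eq : ‖l • (√a • e + √b • e')‖ = l * ‖√a • e + √b • e'‖ := by
    rw [norm_smul, Real.norm_of_nonneg hl.le]
  have norm_smul_lt := mul_lt_mul_of_pos_left norm_lt hl
  have hsum := apply_eq (x := l • (√a • e + √b • e')) (by linarith) (by nlinarith)
  have hright := apply_eq (x := √b • e') (by linarith) (by linarith)
  rw [norm_smul_eq, mul_pow, norm_sq] at hsum
  rw [norm_sqrt_smul b he', Real.sq_sqrt hb.le] at hright
  simp only [← hsum, ← hright]
  exact hf.apply_smul_add hl (sqrt_smul_ne_zero ha he) (sqrt_smul_ne_zero hb he') hxy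
    ((mul_lt_mul_of_pos_left norm_lt (by positivity)).trans_le hρR)

theorem eventually_eq_norm_sq_of_even (hX : 1 < Module.rank ℝ X) (hl : 0 < l) (hl2 : 2 * l ≠ 1)
    (hR : 0 < R) (hf : IsOrthJensenBelow l R f) (heven : f.Even) :
    ∃ A : ℝ →+ Y, (∀ t, A (l ^ 2 * t) = l • A t) ∧ ∀ᶠ x in 𝓝[≠] 0, f x = A (‖x‖ ^ 2) := by
  obtain ⟨h, ρ, hρ, hfh, hh⟩ := hf.exists_radial_profile_of_even hX hl hR heven
  obtain ⟨A, hhA, hA⟩ :=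
    exists_addMonoidHom_of_scaled_jensen (by positivity) hl.ne' hl2 (by positivity) hh
  have eventually_lt : ∀ᶠ x : X in 𝓝 0, ‖x‖ < ρ ∧ ‖x‖ ^ 2 < ρ ^ 2 / 2 :=
    (continuous_norm.tendsto' 0 0 norm_zero |>.eventually_lt_const hρ).and <|
      (by fun_prop : Continuous fun x : X => ‖x‖ ^ 2).tendsto' 0 0 (by simp)
        |>.eventually_lt_const (by positivity)
  refine ⟨A, hA, ?_⟩
  filter_upwards [self_mem_nhdsWithin, nhdsWithin_le_nhds eventually_lt] with x hx ⟨hxρ, hxρ'⟩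
  rw [hfh x hxρ, hhA _ (pow_pos (norm_pos_iff.mpr hx) 2) hxρ']

end Even

section Odd

theorem apply_smul_smul_add (hl : 0 < l) (hf : IsOrthJensenBelow l R f) {x w : X} (hx : x ≠ 0)
    {c d : ℝ} (hc : 0 < c) (hd : 0 < d) (hxw : inner ℝ x w = 0) (hw : ‖w‖ ^ 2 = c * d * ‖x‖ ^ 2)
    (hR : (1 + l) * ((c + d) * ‖x‖) < R) : f (l • (c • x + w)) = l • (f (c • x) + f w) := by
  have hcxw : inner ℝ (c • x) w = 0 := by rw [inner_smul_left, hxw, mul_zero]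
  have hw0 : w ≠ 0 := by
    rintro rfl
    have : 0 < c * d * ‖x‖ ^ 2 := by positivity
    rw [← hw, norm_zero, sq, mul_zero] at this
    exact this.false
  refine hf.apply_smul_add hl (smul_ne_zero hc.ne' hx) hw0 hcxw (lt_of_le_of_lt ?_ hR)
  gcongr
  rw [← sq_le_sq₀ (norm_nonneg _) (by positivity), norm_add_sq_of_inner_eq_zero hcxw, hw,
    norm_smul, mul_pow, Real.norm_eq_abs, sq_abs, mul_pow, ← add_mul]
  gcongr
  nlinarith [mul_pos hc hd]

theorem apply_sq_mul_add_smul_of_odd (hX : 1 < Module.rank ℝ X) (hl : 0 < l)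
    (hf : IsOrthJensenBelow l R f) (hodd : f.Odd) {x : X} (hx : x ≠ 0) {a b : ℝ} (ha : 0 < a)
    (hb : 0 < b) (hab : (1 + l) ^ 2 * ((a + b) * ‖x‖) < R) :
    f ((l ^ 2 * (a + b)) • x) = l ^ 2 • (f (a • x) + f (b • x)) := by
  -- `y` is scaled so that `l • (a • x + y)` and `l • (b • x - y)` are orthogonal.
  obtain ⟨y, hxy, hy⟩ := exists_inner_eq_zero_and_norm_eq hX x (ρ := √(a * b) * ‖x‖) (by positivity)
  have norm_y_sq : ‖y‖ ^ 2 = a * b * ‖x‖ ^ 2 := by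
    rw [hy, mul_pow, Real.sq_sqrt (by positivity)]
  have hxy' : inner ℝ x (-y) = 0 := by rw [inner_neg_right, hxy, neg_zero]
  have hax : inner ℝ (a • x) y = 0 := by rw [inner_smul_left, hxy, mul_zero]
  have hbx : inner ℝ (b • x) (-y) = 0 := by rw [inner_smul_left, hxy', mul_zero]
  have horth : inner ℝ (l • (a • x + y)) (l • (b • x + -y)) = 0 := by
    simp only [inner_smul_left, inner_smul_right, inner_add_left, inner_add_right,
      inner_neg_right, hxy, real_inner_comm, real_inner_self_eq_norm_sq, norm_y_sq, conj_trivial]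
    ring
  have hsum : l • (a • x + y) + l • (b • x + -y) = (l * (a + b)) • x := by module
  have hR : (1 + l) * ((a + b) * ‖x‖) < R := by
    refine lt_of_le_of_lt ?_ hab
    gcongr
    nlinarith
  have hR' : (1 + l) * ‖l • (a • x + y) + l • (b • x + -y)‖ < R := by
    rw [hsum, norm_smul, Real.norm_of_nonneg (by positivity), mul_assoc]
    refine lt_of_le_of_lt ?_ hab
    rw [sq, mul_assoc (1 + l)]
    gcongr
    linarith
  have := hf.apply_smul_add hl
    (smul_ne_zero hl.ne' (add_ne_zero_of_inner_eq_zero hax (smul_ne_zero ha.ne' hx)))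
    (smul_ne_zero hl.ne' (add_ne_zero_of_inner_eq_zero hbx (smul_ne_zero hb.ne' hx))) horth hR'
  rw [hsum, smul_smul, ← mul_assoc, ← sq, hf.apply_smul_smul_add hl hx ha hb hxy norm_y_sq hR,
    hf.apply_smul_smul_add hl hx hb ha hxy' (by rw [norm_neg, norm_y_sq, mul_comm a])
      (by rwa [add_comm b]), hodd] at this
  rw [this]
  module

theorem exists_addMonoidHom_on_line_of_odd (hX : 1 < Module.rank ℝ X) (hl : 0 < l)
    (hl2 : 2 * l ^ 2 ≠ 1) (hR : 0 < R) (hf : IsOrthJensenBelow l R f) (hodd : f.Odd) (x : X) :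
    ∃ A : ℝ →+ Y, ∀ a : ℝ, 2 * (1 + l) ^ 2 * ‖a • x‖ < R → f (a • x) = A a := by
  have := IsAddTorsionFree.of_isTorsionFree ℝ Y
  rcases eq_or_ne x 0 with rfl | hx
  · exact ⟨0, fun a _ => by simp [hodd.map_zero]⟩
  have hc : 0 < (1 + l) ^ 2 * ‖x‖ := by positivity
  obtain ⟨A, hA, -⟩ := exists_addMonoidHom_of_scaled_jensen (h := fun a => f (a • x))
    (m := l ^ 2) (k := l ^ 2) (ρ := R / ((1 + l) ^ 2 * ‖x‖)) (by positivity) (by positivity) hl2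
    (by positivity) fun a b ha hb hab => by
      rw [lt_div_iff₀' hc] at hab
      exact hf.apply_sq_mul_add_smul_of_odd hX hl hodd hx ha hb (by linarith)
  have apply_pos {a : ℝ} (ha : 0 < a) (haR : 2 * (1 + l) ^ 2 * ‖a • x‖ < R) : f (a • x) = A a := by
    refine hA a ha ?_
    rw [norm_smul, Real.norm_of_nonneg ha.le] at haR
    rw [lt_div_iff₀ two_pos, lt_div_iff₀' hc]
    linarith
  refine ⟨A, fun a haR => ?_⟩
  rcases lt_trichotomy a 0 with ha | rfl | ha
  · have := apply_pos (neg_pos.mpr ha) (by rwa [neg_smul, norm_neg])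
    rwa [neg_smul, hodd, map_neg, neg_inj] at this
  · rw [zero_smul, hodd.map_zero, map_zero]
  · exact apply_pos ha haR

variable {q : ℚ}

theorem map_add_of_inner_eq_zero_of_odd (hX : 1 < Module.rank ℝ X) (hq : (0 : ℝ) < q)
    (hq2 : 2 * (q : ℝ) ^ 2 ≠ 1) (hf : IsOrthJensenBelow q R f) (hodd : f.Odd) {x y : X}
    (hxy : inner ℝ x y = 0) (hR : 2 * (1 + q) ^ 3 * ‖x + y‖ < R) : f (x + y) = f x + f y := by
  have := IsAddTorsionFree.of_isTorsionFree ℝ Y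
  rcases eq_or_ne x 0 with rfl | hx
  · rw [zero_add, hodd.map_zero, zero_add]
  rcases eq_or_ne y 0 with rfl | hy
  · rw [add_zero, hodd.map_zero, add_zero]
  obtain ⟨A, hA⟩ := hf.exists_addMonoidHom_on_line_of_odd hX hq hq2
    ((by positivity : 0 ≤ 2 * (1 + (q : ℝ)) ^ 3 * ‖x + y‖).trans_lt hR) hodd (x + y)
  have le_norm {c : ℝ} (hc : c ≤ 2 * (1 + (q : ℝ)) ^ 3) : c * ‖x + y‖ < R :=
    (mul_le_mul_of_nonneg_right hc (norm_nonneg _)).trans_lt hR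
  have apply_one : f (x + y) = A 1 := by
    simpa using hA 1 (by rw [one_smul]; exact le_norm (by nlinarith [sq_nonneg (1 + (q : ℝ))]))
  have apply_ratio : f ((q : ℝ) • (x + y)) = (q : ℝ) • A 1 := by
    rw [hA q, ← map_ratCast_smul A ℝ ℝ, smul_eq_mul, mul_one]
    rw [norm_smul, Real.norm_of_nonneg hq.le, ← mul_assoc]
    exact le_norm (by nlinarith [sq_nonneg (1 + (q : ℝ))])
  rw [hf.apply_smul_add hq hx hy hxy (le_norm (by nlinarith [pow_pos hq 2, pow_pos hq 3])),
    ← apply_one] at apply_ratio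
  exact (smul_right_injective Y hq.ne' apply_ratio).symm

theorem eventually_eq_addMonoidHom_of_odd (hX : 1 < Module.rank ℝ X) (hq : (0 : ℝ) < q)
    (hq2 : 2 * (q : ℝ) ^ 2 ≠ 1) (hR : 0 < R) (hf : IsOrthJensenBelow q R f) (hodd : f.Odd) :
    ∃ T : X →+ Y, ∀ᶠ x in 𝓝 0, f x = T x := by
  have hc : (0 : ℝ) < 2 * (1 + q) ^ 3 := by positivity
  have hδ : 0 < R / (2 * (1 + (q : ℝ)) ^ 3) := by positivity
  obtain ⟨T, hT⟩ : ∃ T : X →+ Y, EqOn f T (ball 0 (R / (2 * (1 + (q : ℝ)) ^ 3))) := by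
    refine exists_addMonoidHom_eqOn_ball fun u hu v hv huv => ?_
    rw [mem_ball_zero_iff] at hu hv huv
    refine map_add_of_map_add_orthogonal_of_map_add_line (fun x y hxy hR => ?_)
      (fun x a b ha hb hab => ?_) hu hv huv
    · exact hf.map_add_of_inner_eq_zero_of_odd hX hq hq2 hodd hxy ((lt_div_iff₀' hc).mp hR)
    · obtain ⟨A, hA⟩ := hf.exists_addMonoidHom_on_line_of_odd hX hq hq2 hR hodd x
      have apply_eq {a : ℝ} (ha : ‖a • x‖ < R / (2 * (1 + (q : ℝ)) ^ 3)) : f (a • x) = A a := by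
        refine hA a (lt_of_le_of_lt ?_ ((lt_div_iff₀' hc).mp ha))
        gcongr
        · linarith
        · norm_num
      rw [apply_eq ha, apply_eq hb, apply_eq hab, map_add]
  exact ⟨T, hT.eventuallyEq_of_mem (ball_mem_nhds 0 hδ)⟩

end Odd

theorem eq_addMonoidHom_add_norm_sq (hX : 1 < Module.rank ℝ X) {q : ℚ} (hq : (0 : ℝ) < q)
    (hq2 : 1 < 2 * (q : ℝ) ^ 2) (hR : 0 < R) (hf : IsOrthJensenBelow q R f) :
    ∃ (T : X →+ Y) (A : ℝ →+ Y), ∀ x, x ≠ 0 → ‖x‖ < R → f x = T x + A (‖x‖ ^ 2) := by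
  obtain ⟨T, hT⟩ := ((hf.sub hf.comp_neg).const_smul (1 / 2)).eventually_eq_addMonoidHom_of_odd
    hX hq hq2.ne' hR fun x => by
      simp only [Pi.smul_apply, Pi.sub_apply, neg_neg]
      module
  obtain ⟨A, hA, hfA⟩ := ((hf.add hf.comp_neg).const_smul (1 / 2)).eventually_eq_norm_sq_of_even
    hX hq (fun h => by nlinarith) hR fun x => by
      simp only [Pi.smul_apply, Pi.add_apply, neg_neg, add_comm]
  have hdiff := (hf.sub (of_addMonoidHom (map_ratCast_smul T ℝ ℝ q))).sub (comp_norm_sq hA)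
  have hdiff_zero : ∀ᶠ x in 𝓝[≠] (0 : X), (f - T - fun x : X => A (‖x‖ ^ 2) : X → Y) x = 0 := by
    filter_upwards [nhdsWithin_le_nhds hT, hfA] with x hTx hAx
    simp only [Pi.smul_apply, Pi.sub_apply, Pi.add_apply] at hTx hAx ⊢
    rw [← hTx, ← hAx]
    module
  refine ⟨T, A, fun x hx hxR => ?_⟩
  have := hdiff.eq_zero_of_eventually_eq_zero hX hq2 hdiff_zero hx hxR
  rwa [Pi.sub_apply, Pi.sub_apply, sub_sub, sub_eq_zero] at this

end IsOrthJensenBelow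

theorem IsOrthogonallyGeneralizedJensenOn.isOrthJensenBelow {X Y : Type*} [NormedAddCommGroup X]
    [InnerProductSpace ℝ X] [AddCommGroup Y] [Module ℝ Y] {r s : ℕ} (hr : 0 < r) (hs : 0 < s)
    {R : ℝ} {f : X → Y} (hf : IsOrthogonallyGeneralizedJensenOn r s s (ball 0 R \ {0}) f) :
    IsOrthJensenBelow ((s : ℝ) / r) R f := by
  intro x y hx hy hxy hxR hyR hR
  have hr0 : (r : ℝ) ≠ 0 := by positivity
  have hl0 : (s : ℝ) / r ≠ 0 := by positivity
  have hsmul : (r : ℝ)⁻¹ • ((s : ℝ) • x + (s : ℝ) • y) = ((s : ℝ) / r) • (x + y) := by module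
  have := hf x ⟨mem_ball_zero_iff.mpr hxR, hx⟩ y ⟨mem_ball_zero_iff.mpr hyR, hy⟩ hxy <| by
    rw [hsmul]
    exact ⟨mem_ball_zero_iff.mpr hR, smul_ne_zero hl0 (add_ne_zero_of_inner_eq_zero hxy hx)⟩
  rw [hsmul, ← smul_add] at this
  rw [← inv_smul_smul₀ hr0 (f _), this, smul_smul, inv_mul_eq_div]

theorem one_lt_two_mul_div_sq {r s : ℝ} (hr : 0 < r) (hsr : 1 / √2 * r < s) :
    1 < 2 * (s / r) ^ 2 := by
  have hlt : 1 / √2 < s / r := (lt_div_iff₀ hr).mpr hsr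
  calc
    (1 : ℝ) = 2 * (1 / √2) ^ 2 := by norm_num
    _ < 2 * (s / r) ^ 2 := by gcongr

theorem theorem6p2_general {X Y : Type*} [NormedAddCommGroup X] [InnerProductSpace ℝ X]
    (hX : 1 < Module.rank ℝ X) [AddCommGroup Y] [Module ℝ Y] (r s : ℕ) (hr : 0 < r)
    (hsr : 1 / Real.sqrt 2 * (r : ℝ) < (s : ℝ)) (R : ℝ) (hR : 0 < R) (f : X → Y)
    (hf : IsOrthogonallyGeneralizedJensenOn r s s (Metric.ball (0 : X) R \ {0}) f) :
    ∃ (T : X →+ Y) (b : NNReal →+ Y),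
      ∀ x ∈ Metric.ball (0 : X) R \ {0}, f x = T x + b (‖x‖₊ ^ 2) := by
  have hs : 0 < s := by exact_mod_cast (by positivity : 0 ≤ 1 / √2 * (r : ℝ)).trans_lt hsr
  have hcast : ((s / r : ℚ) : ℝ) = s / r := by push_cast; rfl
  have hJensen : IsOrthJensenBelow ((s / r : ℚ) : ℝ) R f := hcast ▸ hf.isOrthJensenBelow hr hs
  obtain ⟨T, A, hTA⟩ := hJensen.eq_addMonoidHom_add_norm_sq hX (by rw [hcast]; positivity)
    (hcast ▸ one_lt_two_mul_div_sq (by positivity) hsr) hR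
  exact ⟨T, A.comp NNReal.toRealHom.toAddMonoidHom, fun x hx => by
    simpa using hTA x hx.2 (mem_ball_zero_iff.mp hx.1)⟩

theorem theorem6p2 {X Y : Type*} [NormedAddCommGroup X] [InnerProductSpace ℝ X]
    (hX : 1 < Module.rank ℝ X)
    [AddCommGroup Y] [Module ℝ Y] [UniformSpace Y] [IsUniformAddGroup Y] [ContinuousSMul ℝ Y]
    (hY : IsSequentiallyComplete Y)
    (r s t : ℕ) (hr : 0 < r) (hs : 0 < s) (ht : 0 < t)
    (hst : s = t) (hsr : 1 / Real.sqrt 2 * (r : ℝ) < (s : ℝ))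
    (R : ℝ) (hR : 0 < R) (f : X → Y)
    (hf : IsOrthogonallyGeneralizedJensenOn r s t (Metric.ball (0 : X) R \ {0}) f) :
    ∃ (T : X →+ Y) (b : NNReal →+ Y),
      ∀ x ∈ Metric.ball (0 : X) R \ {0}, f x = T x + b (‖x‖₊ ^ 2) := by
  subst hst
  exact theorem6p2_general hX r s hr hsr R hR f hf
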